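/- Let $(A,B,c)$ be a random triple with values in $\mathbf R^{n\times n}\times\mathbf R^{n\times m}\times\mathbf R^n$ having the common distribution of the i.i.d. dynamics triples $(A_t,B_t,c_t)$ of the system $x_{t+1}=A_tx_t+B_tu_t+c_t$. Assume the means $\bar A=\mathbf E A$, $\bar B=\mathbf E B$, $\bar c=\mathbf E c$ exist, and let the stage cost $g:\mathbf R^n\times\mathbf R^m\to\mathbf R\cup\{\infty\}$ be closed and convex. For an extended-real-valued random variable $Y$ put $\mathbf E Y=\mathbf E Y^+-\mathbf E Y^-$. Let $\mathcal T$ be the Bellman operator $$(\mathcal T h)(x)=\inf_{u}\bigl(g(x,u)+\mathbf E\,h(Ax+Bu+c)\bigr).$$ A function $V:\mathbf R^n\to\mathbf R\cup\{\infty\}$ is called a value function if $V+J=\mathcal T V$ for some constant $J\in\mathbf R$. Let $V^{\rm ce}:\mathbf R^n\to\mathbf R\cup\{\infty\}$ be a convex, Borel measurable solution of the Bellman equation of the certainty-equivalent problem, $$V^{\rm ce}(x)=\inf_u\bigl(g(x,u)+V^{\rm ce}(\bar Ax+\bar Bu+\bar c)\bigr)\quad\text{for all }x\in\mathbf R^n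 .$$ Then, with all inequalities between functions understood pointwise: 1. $V^{\rm ce}(\bar Ax+\bar Bu+\bar c)\le \mathbf E\,V^{\rm ce}(Ax+Bu+c)$ for all $x,u$ (Jensen's inequality). 2. $V^{\rm ce}\le\mathcal T V^{\rm ce}$. 3. $\mathcal T$ is monotone: $h_1\le h_2$ implies $\mathcal T h_1\le\mathcal T h_2$. Moreover $\mathcal T^kV^{\rm ce}\le\mathcal T^{k+1}V^{\rm ce}$ for all $k\ge 0$. 4. The value iterates $\mathcal T^kV^{\rm ce}$ converge pointwise, as $k\to\infty$, to an extended-real-valued limit, and $V^{\rm ce}\le\mathcal T V^{\rm ce}\le\lim_{k\to\infty}\mathcal T^kV^{\rm ce}$. 5. Consequently, if value iteration started at $V^{\rm ce}$ converges pointwise to a value function $V^\star$, i.e. $\lim_{k\to\infty}\mathcal T^kV^{\rm ce}=V^\star$, then $V^{\rm ce}\le\mathcal T V^{\rm ce}\le V^\star$, so $V^{\rm ce}$ is a lower bound on $V^\star$. -/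

import Mathlib

open MeasureTheory Filter Topology
open scoped Matrix

noncomputable section

/-- Convexity of an extended-real-valued function: its epigraph is convex. -/
def IsConvexFun {E : Type*} [AddCommGroup E] [Module ℝ E] (f : E → EReal) : Prop :=
  Convex ℝ {p : E × ℝ | f p.1 ≤ (p.2 : EReal)}

/-- Expectation of an extended-real-valued random variable, `E Y = E Y⁺ - E Y⁻`. -/
def eexpect {Ω : Type*} [MeasurableSpace Ω] (P : Measure Ω) (Y : Ω → EReal) : EReal :=
  ((∫⁻ ω, (Y ω).toENNReal ∂P : ENNReal) : EReal) - ((∫⁻ ω, (-Y ω).toENNReal ∂P : ENNReal) : EReal)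

/-- Data of a convex stochastic control problem with state space `ℝⁿ` and input space `ℝᵐ`.
The triple `(A, B, c)` is a random variable with the common distribution of the
i.i.d. dynamics triples `(A_t, B_t, c_t)`, whose expectation exists; the stage cost `g`
is a closed convex function with values in `ℝ ∪ {∞}`. -/
structure ConvexControlProblem (n m : ℕ) (Ω : Type*) [MeasurableSpace Ω] where
  P : Measure Ω
  isProb : IsProbabilityMeasure P
  A : Ω → Matrix (Fin n) (Fin n) ℝ
  B : Ω → Matrix (Fin n) (Fin m) ℝ
  c : Ω → Fin n → ℝ
  integrable_A : ∀ i j, Integrable (fun ω => A ω i j) P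
  integrable_B : ∀ i j, Integrable (fun ω => B ω i j) P
  integrable_c : ∀ i, Integrable (fun ω => c ω i) P
  g : (Fin n → ℝ) × (Fin m → ℝ) → EReal
  g_ne_bot : ∀ p, g p ≠ ⊥
  g_convex : IsConvexFun g
  g_closed : LowerSemicontinuous g

namespace ConvexControlProblem

variable {n m : ℕ} {Ω : Type*} [MeasurableSpace Ω]

/-- The random next state `A x + B u + c`. -/
def next (S : ConvexControlProblem n m Ω) (x : Fin n → ℝ) (u : Fin m → ℝ) (ω : Ω) : Fin n → ℝ :=
  S.A ω *ᵥ x + S.B ω *ᵥ u + S.c ω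

/-- `E A`. -/
def Abar (S : ConvexControlProblem n m Ω) : Matrix (Fin n) (Fin n) ℝ :=
  Matrix.of fun i j => ∫ ω, S.A ω i j ∂S.P

/-- `E B`. -/
def Bbar (S : ConvexControlProblem n m Ω) : Matrix (Fin n) (Fin m) ℝ :=
  Matrix.of fun i j => ∫ ω, S.B ω i j ∂S.P

/-- `E c`. -/
def cbar (S : ConvexControlProblem n m Ω) : Fin n → ℝ :=
  fun i => ∫ ω, S.c ω i ∂S.P

/-- The next state of the certainty-equivalent system. -/
def ceNext (S : ConvexControlProblem n m Ω) (x : Fin n → ℝ) (u : Fin m → ℝ) : Fin n → ℝ :=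
  S.Abar *ᵥ x + S.Bbar *ᵥ u + S.cbar

/-- The Bellman operator `(T h)(x) = inf_u (g(x,u) + E h(A x + B u + c))`. -/
def bellman (S : ConvexControlProblem n m Ω) (h : (Fin n → ℝ) → EReal) : (Fin n → ℝ) → EReal :=
  fun x => ⨅ u : Fin m → ℝ, S.g (x, u) + eexpect S.P (fun ω => h (S.next x u ω))

/-- The Bellman operator of the certainty-equivalent problem. -/
def ceBellman (S : ConvexControlProblem n m Ω) (h : (Fin n → ℝ) → EReal) : (Fin n → ℝ) → EReal :=
  fun x => ⨅ u : Fin m → ℝ, S.g (x, u) + h (S.ceNext x u)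

/-- `V : ℝⁿ → ℝ ∪ {∞}` is a value function of the stochastic control problem: it solves the
Bellman equation `V + J = T V` for some constant `J` (`J = 0` being the fixed points of `T`). -/
def IsValueFunction (S : ConvexControlProblem n m Ω) (V : (Fin n → ℝ) → EReal) : Prop :=
  (∀ x, V x ≠ ⊥) ∧ ∃ J : ℝ, ∀ x, V x + (J : EReal) = S.bellman V x

/-- Value iteration started at `V₀` converges pointwise to `V`. -/
def ValueIterationTendsto (S : ConvexControlProblem n m Ω) (V₀ V : (Fin n → ℝ) → EReal) : Prop :=
  ∀ x, Tendsto (fun k : ℕ => (S.bellman^[k] V₀) x) atTop (𝓝 (V x))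

end ConvexControlProblem

end

/-! Everything rests on Jensen's inequality for a convex `V` that may be infinite and need not be
closed. The pair (X, R), with R an integrable real majorant of V(X), lies a.s. in the epigraph of
`V`; in finite dimension its mean stays there even if the epigraph is not closed
(`Convex.integral_mem_of_finiteDimensional`). The negative part of V(X) must also be shown
integrable, since ⊤ - ⊤ = ⊥ in `EReal` would break the inequality. Jensen gives `Vce ≤ T Vce`;
monotonicity of `T` then makes the iterates increase, so they converge to their supremum. -/

/-- In finite dimension, for a point outside a nonempty convex set there is a nonzero functional
which is bounded on the set by its value at the point, or constant on the set. -/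
theorem Convex.exists_dual_ne_zero_forall_le {E : Type*} [NormedAddCommGroup E]
    [NormedSpace ℝ E] [FiniteDimensional ℝ E] {C : Set E} (hC : Convex ℝ C) (hne : C.Nonempty)
    {x : E} (hx : x ∉ C) : ∃ f : E →L[ℝ] ℝ, f ≠ 0 ∧ ((∀ y ∈ C, f y ≤ f x) ∨
      ∃ a, ∀ y ∈ C, f y = a) := by
  by_cases hint : (interior C).Nonempty
  · obtain ⟨f, hf⟩ := geometric_hahn_banach_open_point hC.interior isOpen_interior
      (fun h => hx (interior_subset h))
    refine ⟨f, ?_, Or.inl fun y hy => ?_⟩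
    · rintro rfl
      obtain ⟨y, hy⟩ := hint
      simpa using hf y hy
    · have hcl : closure (interior C) ⊆ {y | f y ≤ f x} :=
        closure_minimal (fun y hy => (hf y hy).le) (isClosed_le f.continuous continuous_const)
      rw [hC.closure_interior_eq_closure_of_nonempty_interior hint] at hcl
      exact hcl (subset_closure hy)
  -- With empty interior, `C` lies in a proper affine subspace, so some nonzero functional kills all
  -- differences of its points.
  · rw [hC.interior_nonempty_iff_affineSpan_eq_top] at hint
    have hdir : vectorSpan ℝ C < ⊤ := by
      refine lt_top_iff_ne_top.2 fun h => hint ?_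
      rwa [← direction_affineSpan, AffineSubspace.direction_eq_top_iff_of_nonempty
        (hne.mono (subset_affineSpan ℝ C))] at h
    obtain ⟨f, hf0, hf⟩ := Submodule.exists_le_ker_of_lt_top _ hdir
    obtain ⟨z, hz⟩ := hne
    refine ⟨f.toContinuousLinearMap, ?_, Or.inr ⟨f z, fun y hy => ?_⟩⟩
    · simpa using hf0
    · have := hf (vsub_mem_vectorSpan ℝ hy hz)
      simpa [sub_eq_zero] using this

/-- In finite dimension the mean of an integrable random vector with values in a convex set,
closed or not, belongs to that set. -/
theorem Convex.integral_mem_of_finiteDimensional {Ω : Type*} [MeasurableSpace Ω] {P : Measure Ω}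
    [IsProbabilityMeasure P] {E : Type*} [NormedAddCommGroup E]
    [NormedSpace ℝ E] [FiniteDimensional ℝ E] {C : Set E} (hC : Convex ℝ C) {X : Ω → E}
    (hX : Integrable X P) (hXC : ∀ᵐ ω ∂P, X ω ∈ C) : ∫ ω, X ω ∂P ∈ C := by
  induction hd : Module.finrank ℝ E using Nat.strong_induction_on generalizing E with
  | _ d ih =>
  by_contra hmem
  obtain ⟨ω₀, hω₀⟩ := hXC.exists
  obtain ⟨f, hf0, hf⟩ := hC.exists_dual_ne_zero_forall_le ⟨_, hω₀⟩ hmem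
  set x := ∫ ω, X ω ∂P with hx
  have hfX : Integrable (fun ω => f (X ω)) P := f.integrable_comp hX
  have hint : ∫ ω, f (X ω) ∂P = f x := f.integral_comp_comm hX
  -- `f (X ω)` has mean `f x`; being a.s. at most `f x`, or a.s. constant, it equals `f x` a.s.
  have hker : ∀ᵐ ω ∂P, f (X ω) = f x := by
    rcases hf with hf | ⟨a, ha⟩
    · have h0 : 0 ≤ᵐ[P] fun ω => f x - f (X ω) := by
        filter_upwards [hXC] with ω hω
        exact sub_nonneg.2 (hf _ hω)
      have h1 := (integral_eq_zero_iff_of_nonneg_ae h0 ((integrable_const _).sub hfX)).1 (by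
        rw [integral_sub (integrable_const _) hfX, hint]; simp)
      filter_upwards [h1] with ω hω
      simp only [Pi.zero_apply] at hω
      linarith
    · have h1 : ∀ᵐ ω ∂P, f (X ω) = a := by
        filter_upwards [hXC] with ω hω using ha _ hω
      have h2 : f x = a := by
        rw [← hint, integral_congr_ae h1]; simp
      filter_upwards [h1] with ω hω
      rw [hω, h2]
  let K : Submodule ℝ E := f.ker
  -- `X ω - x` lies in `K` only a.s.; projecting gives a `K`-valued vector everywhere. Its mean is
  -- 0, so induction on the slice `C'` puts `x` in `C`.
  obtain ⟨p, hp⟩ := Submodule.exists_isCompl K |>.elim fun q hq =>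
    (⟨K.projectionOnto q hq, Submodule.projectionOnto_apply_left hq⟩ :
      ∃ p : E →ₗ[ℝ] K, ∀ v : K, p v = v)
  let p' : E →L[ℝ] K := p.toContinuousLinearMap
  let C' : Set K := {v | (v : E) + x ∈ C}
  have hC' : Convex ℝ C' := by
    intro v hv w hw a b ha hb hab
    have := hC hv hw ha hb hab
    have e : a • ((v : E) + x) + b • ((w : E) + x) = ((a • v + b • w : K) : E) + x := by
      simp only [smul_add, Submodule.coe_add, Submodule.coe_smul]
      nth_rewrite 3 [← one_smul ℝ x]
      rw [← hab, add_smul]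
      abel
    rwa [e] at this
  have hXs : Integrable (fun ω => X ω - x) P := hX.sub (integrable_const _)
  have hY : Integrable (fun ω => p' (X ω - x)) P := p'.integrable_comp hXs
  have hYC : ∀ᵐ ω ∂P, p' (X ω - x) ∈ C' := by
    filter_upwards [hker, hXC] with ω h1 h2
    have hk : X ω - x ∈ K := by
      change f (X ω - x) = 0
      rw [map_sub, h1, sub_self]
    have : p' (X ω - x) = ⟨X ω - x, hk⟩ := hp ⟨X ω - x, hk⟩
    rw [this]
    simpa [C'] using h2
  have hlt : Module.finrank ℝ K < d := by
    rw [← hd]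
    refine Submodule.finrank_lt fun h => hf0 ?_
    ext v
    have : v ∈ K := h ▸ Submodule.mem_top
    exact this
  have hfin := ih _ hlt hC' hY hYC rfl
  rw [p'.integral_comp_comm hXs, integral_sub hX (integrable_const _)] at hfin
  refine hmem ?_
  simpa [C', ← hx] using hfin

theorem eexpect_mono {Ω : Type*} [MeasurableSpace Ω] (P : Measure Ω) {Y Z : Ω → EReal}
    (h : Y ≤ Z) : eexpect P Y ≤ eexpect P Z := by
  refine EReal.sub_le_sub ?_ ?_
  · exact EReal.coe_ennreal_le_coe_ennreal_iff.2
      (lintegral_mono fun ω => EReal.toENNReal_le_toENNReal (h ω))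
  · exact EReal.coe_ennreal_le_coe_ennreal_iff.2
      (lintegral_mono fun ω => EReal.toENNReal_le_toENNReal (EReal.neg_le_neg_iff.2 (h ω)))

/-! ### Jensen's inequality for extended-real convex functions -/

namespace IsConvexFun

variable {Ω : Type*} [MeasurableSpace Ω] {P : Measure Ω} [IsProbabilityMeasure P]
  {E : Type*} [NormedAddCommGroup E] [NormedSpace ℝ E] [FiniteDimensional ℝ E]
  {V : E → EReal} {X : Ω → E}

/-- Jensen's inequality for an integrable real majorant of `V ∘ X`. -/
theorem map_integral_le_of_le (hV : IsConvexFun V) (hX : Integrable X P) {R : Ω → ℝ}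
    (hR : Integrable R P) (hVR : ∀ᵐ ω ∂P, V (X ω) ≤ (R ω : EReal)) :
    V (∫ ω, X ω ∂P) ≤ ((∫ ω, R ω ∂P : ℝ) : EReal) := by
  have h := Convex.integral_mem_of_finiteDimensional (P := P)
    (X := fun ω => (X ω, R ω)) hV (hX.prodMk hR) hVR
  rw [integral_pair hX hR] at h
  exact h

/-- Where V(X) < 0, truncating the negative part at `N` gives a bounded real majorant of V(X). If
the integral were infinite, the bounds would tend to -∞ and force `V = ⊥` at the mean. -/
theorem lintegral_neg_ne_top_of_neg (hV : IsConvexFun V) (hbot : ∀ x, V x ≠ ⊥)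
    (hX : Integrable X P) (hVX : AEMeasurable (fun ω => V (X ω)) P)
    (hneg : ∀ᵐ ω ∂P, V (X ω) < 0) : ∫⁻ ω, (-V (X ω)).toENNReal ∂P ≠ ⊤ := by
  intro htop
  set F : Ω → ENNReal := fun ω => (-V (X ω)).toENNReal with hF
  have hFm : AEMeasurable F P := hVX.neg.ereal_toENNReal
  have hbound : ∀ N : ℕ, V (∫ ω, X ω ∂P) ≤ -((∫⁻ ω, min (F ω) N ∂P : ENNReal) : EReal) := by
    intro N
    have hm : AEMeasurable (fun ω => min (F ω) (N : ENNReal)) P := hFm.min aemeasurable_const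
    have hne : ∀ ω, min (F ω) (N : ENNReal) ≠ ⊤ := fun ω =>
      ne_top_of_le_ne_top (ENNReal.natCast_ne_top N) (min_le_right _ _)
    have hlt : ∫⁻ ω, min (F ω) (N : ENNReal) ∂P ≠ ⊤ := by
      refine ne_top_of_le_ne_top (ENNReal.natCast_ne_top N) ?_
      calc ∫⁻ ω, min (F ω) (N : ENNReal) ∂P ≤ ∫⁻ _, (N : ENNReal) ∂P :=
            lintegral_mono fun ω => min_le_right _ _
        _ = N := by simp
    have hR : Integrable (fun ω => (min (F ω) (N : ENNReal)).toReal) P :=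
      integrable_toReal_of_lintegral_ne_top hm hlt
    have h := hV.map_integral_le_of_le hX hR.neg (by
      filter_upwards [hneg] with ω hω
      have h0 : (0 : EReal) ≤ -V (X ω) := EReal.neg_nonneg.2 hω.le
      rw [Pi.neg_apply, EReal.coe_neg, EReal.coe_ennreal_toReal (hne ω), EReal.le_neg]
      refine (EReal.coe_ennreal_le_coe_ennreal_iff.2 (min_le_left _ _)).trans ?_
      rw [hF, EReal.coe_toENNReal h0])
    simp only [Pi.neg_apply] at h
    rwa [integral_neg, integral_toReal hm (ae_of_all _ fun ω => (hne ω).lt_top), EReal.coe_neg,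
      EReal.coe_ennreal_toReal hlt] at h
  have hsup : ⨆ N : ℕ, ∫⁻ ω, min (F ω) (N : ENNReal) ∂P = ⊤ := by
    rw [← lintegral_iSup' (fun N => hFm.min aemeasurable_const)
      (ae_of_all _ fun ω a b hab => min_le_min_left _ (Nat.cast_le.2 hab)), ← htop]
    refine lintegral_congr fun ω => ?_
    rw [← inf_iSup_eq, ENNReal.iSup_natCast, inf_top_eq]
  refine hbot (∫ ω, X ω ∂P) ((EReal.eq_bot_iff_forall_lt _).2 fun y => ?_)
  have hlt : ENNReal.ofReal (-y) < ⨆ N : ℕ, ∫⁻ ω, min (F ω) (N : ENNReal) ∂P := by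
    rw [hsup]; exact ENNReal.ofReal_lt_top
  obtain ⟨N, hN⟩ := lt_iSup_iff.1 hlt
  refine (hbound N).trans_lt (EReal.neg_lt_comm.1 ?_)
  refine lt_of_le_of_lt ?_ (EReal.coe_ennreal_lt_coe_ennreal_iff.2 hN)
  rw [EReal.coe_ennreal_ofReal, ← EReal.coe_neg]
  exact EReal.coe_le_coe_iff.2 (le_max_left _ _)

/-- The negative part of a proper convex function of an integrable random vector has finite
expectation. -/
theorem lintegral_neg_ne_top (hV : IsConvexFun V) (hbot : ∀ x, V x ≠ ⊥)
    (hX : Integrable X P) (hVX : AEMeasurable (fun ω => V (X ω)) P) :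
    ∫⁻ ω, (-V (X ω)).toENNReal ∂P ≠ ⊤ := by
  set s : Set Ω := {ω | V (X ω) < 0} with hs
  have hsm : NullMeasurableSet s P := hVX.nullMeasurableSet_preimage measurableSet_Iio
  have hind : ∫⁻ ω, (-V (X ω)).toENNReal ∂P = ∫⁻ ω in s, (-V (X ω)).toENNReal ∂P := by
    rw [← lintegral_indicator₀ hsm]
    refine lintegral_congr fun ω => ?_
    by_cases hω : ω ∈ s
    · rw [Set.indicator_of_mem hω]
    · rw [Set.indicator_of_notMem hω, EReal.toENNReal_eq_zero_iff, EReal.neg_le, neg_zero]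
      exact not_lt.1 hω
  rw [hind]
  -- Otherwise condition on `s`, where `V (X ω)` is negative; normalization does not affect
  -- finiteness.
  by_cases h0 : P s = 0
  · rw [Measure.restrict_eq_zero.2 h0]; simp
  have hinv : (P s)⁻¹ ≠ ⊤ := ENNReal.inv_ne_top.2 h0
  have : IsProbabilityMeasure ((P s)⁻¹ • P.restrict s) :=
    ProbabilityTheory.cond_isProbabilityMeasure h0
  have h := lintegral_neg_ne_top_of_neg (P := (P s)⁻¹ • P.restrict s) hV hbot
    (hX.restrict.smul_measure hinv) (hVX.restrict.smul_measure _)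
    (Measure.ae_smul_measure (ae_restrict_mem₀ hsm) _)
  rw [lintegral_smul_measure] at h
  intro htop
  rw [htop] at h
  exact h (ENNReal.mul_top (ENNReal.inv_ne_zero.2 (measure_ne_top P s)))

/-- Jensen's inequality for a proper, not necessarily closed, convex function on a
finite-dimensional space. -/
theorem map_integral_le_eexpect (hV : IsConvexFun V) (hbot : ∀ x, V x ≠ ⊥)
    (hX : Integrable X P) (hVX : AEMeasurable (fun ω => V (X ω)) P) :
    V (∫ ω, X ω ∂P) ≤ eexpect P (fun ω => V (X ω)) := by
  have hneg := hV.lintegral_neg_ne_top hbot hX hVX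
  unfold eexpect
  set a := ∫⁻ ω, (V (X ω)).toENNReal ∂P with ha
  set b := ∫⁻ ω, (-V (X ω)).toENNReal ∂P with hb
  by_cases hpos : a = ⊤
  · rw [hpos, EReal.coe_ennreal_top, ← EReal.coe_ennreal_toReal hneg, EReal.top_sub_coe]
    exact le_top
  have hpm : AEMeasurable (fun ω => (V (X ω)).toENNReal) P := hVX.ereal_toENNReal
  have hnm : AEMeasurable (fun ω => (-V (X ω)).toENNReal) P := hVX.neg.ereal_toENNReal
  have hpi := integrable_toReal_of_lintegral_ne_top hpm hpos
  have hni := integrable_toReal_of_lintegral_ne_top hnm hneg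
  have hpt := ae_lt_top' hpm hpos
  have hnt := ae_lt_top' hnm hneg
  have h := hV.map_integral_le_of_le hX (hpi.sub hni) (by
    filter_upwards [hpt, hnt] with ω h1 h2
    simp only [Pi.sub_apply]
    rw [EReal.coe_sub, EReal.coe_ennreal_toReal h1.ne, EReal.coe_ennreal_toReal h2.ne]
    rcases le_total 0 (V (X ω)) with h0 | h0
    · rw [EReal.coe_toENNReal h0, EReal.toENNReal_of_nonpos (EReal.neg_le.1 (by simpa using h0))]
      simp
    · rw [EReal.toENNReal_of_nonpos h0, EReal.coe_toENNReal (EReal.neg_nonneg.2 h0)]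
      simp)
  rw [integral_sub' hpi hni, integral_toReal hpm hpt, integral_toReal hnm hnt, EReal.coe_sub,
    EReal.coe_ennreal_toReal hpos, EReal.coe_ennreal_toReal hneg] at h
  exact h

end IsConvexFun

/-! ### The random dynamics and the Bellman operator -/

namespace ConvexControlProblem

variable {n m : ℕ} {Ω : Type*} [MeasurableSpace Ω] (S : ConvexControlProblem n m Ω)

theorem next_apply (x : Fin n → ℝ) (u : Fin m → ℝ) (ω : Ω) (i : Fin n) :
    S.next x u ω i = (∑ j, S.A ω i j * x j + ∑ j, S.B ω i j * u j) + S.c ω i := rfl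

theorem ceNext_apply (x : Fin n → ℝ) (u : Fin m → ℝ) (i : Fin n) :
    S.ceNext x u i = (∑ j, (∫ ω, S.A ω i j ∂S.P) * x j + ∑ j, (∫ ω, S.B ω i j ∂S.P) * u j) +
      ∫ ω, S.c ω i ∂S.P := rfl

theorem integrable_next_apply (x : Fin n → ℝ) (u : Fin m → ℝ) (i : Fin n) :
    Integrable (fun ω => S.next x u ω i) S.P := by
  simp only [next_apply]
  exact ((integrable_finsetSum _ fun j _ => (S.integrable_A i j).mul_const (x j)).add
    (integrable_finsetSum _ fun j _ => (S.integrable_B i j).mul_const (u j))).add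
      (S.integrable_c i)

theorem integrable_next (x : Fin n → ℝ) (u : Fin m → ℝ) : Integrable (S.next x u) S.P :=
  Integrable.of_eval (S.integrable_next_apply x u)

theorem integral_next (x : Fin n → ℝ) (u : Fin m → ℝ) :
    ∫ ω, S.next x u ω ∂S.P = S.ceNext x u := by
  ext i
  rw [eval_integral fun i => S.integrable_next_apply x u i]
  have hA : ∀ j ∈ Finset.univ, Integrable (fun ω => S.A ω i j * x j) S.P :=
    fun j _ => (S.integrable_A i j).mul_const (x j)
  have hB : ∀ j ∈ Finset.univ, Integrable (fun ω => S.B ω i j * u j) S.P :=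
    fun j _ => (S.integrable_B i j).mul_const (u j)
  have hAs := integrable_finsetSum _ hA
  have hBs := integrable_finsetSum _ hB
  simp only [next_apply, ceNext_apply]
  refine (integral_add (hAs.add hBs) (S.integrable_c i)).trans ?_
  rw [integral_add' hAs hBs,
    integral_finsetSum _ hA, integral_finsetSum _ hB]
  simp only [integral_mul_const]

theorem monotone_bellman : Monotone S.bellman := fun _ _ h x =>
  iInf_mono fun u => add_le_add le_rfl (eexpect_mono S.P fun ω => h (S.next x u ω))

theorem ceNext_le_eexpect {V : (Fin n → ℝ) → EReal} (hbot : ∀ x, V x ≠ ⊥)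
    (hconv : IsConvexFun V) (hmeas : Measurable V) (x : Fin n → ℝ) (u : Fin m → ℝ) :
    V (S.ceNext x u) ≤ eexpect S.P (fun ω => V (S.next x u ω)) := by
  have := S.isProb
  rw [← S.integral_next x u]
  exact hconv.map_integral_le_eexpect hbot (S.integrable_next x u)
    (hmeas.comp_aemeasurable (S.integrable_next x u).aestronglyMeasurable.aemeasurable)

end ConvexControlProblem

theorem mainTheorem3 {n m : ℕ} {Ω : Type*} [MeasurableSpace Ω]
    (S : ConvexControlProblem n m Ω) (Vce : (Fin n → ℝ) → EReal)
    (hVce_ne_bot : ∀ x, Vce x ≠ ⊥) (hVce_convex : IsConvexFun Vce)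
    (hVce_meas : Measurable Vce)
    (hVce : Vce = S.ceBellman Vce) :
    -- Jensen's inequality
    (∀ x u, Vce (S.ceNext x u) ≤ eexpect S.P (fun ω => Vce (S.next x u ω))) ∧
    Vce ≤ S.bellman Vce ∧
    -- monotonicity of the Bellman operator
    (∀ h₁ h₂ : (Fin n → ℝ) → EReal, h₁ ≤ h₂ → S.bellman h₁ ≤ S.bellman h₂) ∧
    (∀ k : ℕ, S.bellman^[k] Vce ≤ S.bellman^[k + 1] Vce) ∧
    -- value iteration from `Vce` has a pointwise limit, which is bounded below by `T Vce`
    (∃ Vlim : (Fin n → ℝ) → EReal, S.ValueIterationTendsto Vce Vlim ∧ S.bellman Vce ≤ Vlim) ∧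
    -- if this limit is the value function, then `Vce` is a lower bound on it
    (∀ Vstar : (Fin n → ℝ) → EReal, S.IsValueFunction Vstar →
      S.ValueIterationTendsto Vce Vstar →
        S.bellman Vce ≤ Vstar ∧ Vce ≤ Vstar) := by

  have hJ := S.ceNext_le_eexpect hVce_ne_bot hVce_convex hVce_meas
  have hT : Vce ≤ S.bellman Vce := fun x => by
    conv_lhs => rw [hVce]
    exact iInf_mono fun u => add_le_add le_rfl (hJ x u)
  have hmono : Monotone fun k : ℕ => S.bellman^[k] Vce :=
    S.monotone_bellman.monotone_iterate_of_le_map hT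
  -- An increasing sequence lies below its limit; the index 1 selects the iterate `T Vce`.
  have hlim : ∀ V, S.ValueIterationTendsto Vce V → S.bellman Vce ≤ V := fun V hV x =>
    (show Monotone fun k : ℕ => (S.bellman^[k] Vce) x from
      fun a b hab => hmono hab x).ge_of_tendsto (hV x) 1
  have hsup : S.ValueIterationTendsto Vce fun x => ⨆ k : ℕ, (S.bellman^[k] Vce) x :=
    fun x => tendsto_atTop_iSup fun a b hab => hmono hab x
  exact ⟨hJ, hT, fun _ _ h => S.monotone_bellman h, fun k => hmono k.le_succ,
    ⟨_, hsup, hlim _ hsup⟩, fun V _ hV => ⟨hlim V hV, hT.trans (hlim V hV)⟩⟩
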